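/- Let $n\ge 0$ and let $Q,R\in\mathbb{C}[t]$ be monic polynomials of degree $n$. For a polynomial $S$ of degree $n$, let $\Sigma(S)$ be the multiset of its $n$ complex roots, counted with multiplicity, where the different copies of a repeated root are regarded as distinct elements. Let $\mathcal{P}=(\mathcal{P}_\alpha)_{\alpha\in[0,1]}$ be a continuous path of complex polynomials of degree $n$ with $\mathcal{P}_0=Q$ and $\mathcal{P}_1=R$. A $\mathcal{P}$-root-path set consists of $n$ continuous functions $\gamma_1,\dots,\gamma_n:[0,1]\to\mathbb{C}$ such that $\Sigma(\mathcal{P}_\alpha)=\{\gamma_1(\alpha),\dots,\gamma_n(\alpha)\}$ as multisets for every $\alpha\in[0,1]$. A $\mathcal{P}$-root-pairing is a bijection $p:\Sigma(Q)\to\Sigma(R)$ induced by some $\mathcal{P}$-root-path set via $\gamma_j(0)\mapsto\gamma_j(1)$, $j=1,\dots,n$. Theorem. Let $f,g:[0,1]\to\mathbb{R}$ be continuous functions with $f(0)=g(1)=1$ and $f(1)=g(0)=0$, and let $\mathcal{P}_\alpha=f(\alpha)Q+g(\alpha)R$. Suppose that $\mathcal{P}_\alpha$ has degree $n$ for every $\alpha\in[0,1]$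 (that is, $f(\alpha)+g(\alpha)\neq 0$; this holds in particular if all $\mathcal{P}_\alpha$ are monic of degree $n$), and that $\max(f(\alpha),g(\alpha))\ge 0$ for every $\alpha\in[0,1]$. Then every root-pairing $p:\Sigma(Q)\to\Sigma(R)$ of the convex path $P_\alpha=(1-\alpha)Q+\alpha R$ is also a $\mathcal{P}$-root-pairing. -/

import Mathlib

open Polynomial

/-- The convex polynomial path `α ↦ (1 - α) Q + α R` from `Q` to `R`. -/
noncomputable def convexPolyPath (Q R : ℂ[X]) (α : unitInterval) : ℂ[X] :=
  C (((1 - (α : ℝ) : ℝ)) : ℂ) * Q + C ((α : ℝ) : ℂ) * R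

/-- The family `α ↦ f(α) Q + g(α) R`. -/
noncomputable def combPolyPath (f g : unitInterval → ℝ) (Q R : ℂ[X]) (α : unitInterval) : ℂ[X] :=
  C ((f α : ℝ) : ℂ) * Q + C ((g α : ℝ) : ℂ) * R

/-- `γ₁, …, γₙ` form a root-path set of the family `P` of polynomials of degree `n`: they are
continuous and, for every `α`, the values `γ₁(α), …, γₙ(α)` are the roots of `P α`, with
multiplicity. -/
def IsRootPathSet {n : ℕ} (P : unitInterval → ℂ[X]) (γ : Fin n → unitInterval → ℂ) : Prop :=
  (∀ j, Continuous (γ j)) ∧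
    ∀ α, (P α).roots = (Finset.univ : Finset (Fin n)).val.map (fun j => γ j α)

/-- `p` is a root-pairing of the family `P`, a path from `Q` to `R` in degree `n`.
The elements of the type `↥Q.roots` are the pairs `(ζ, i)` with `i < ` the multiplicity of `ζ`, so
that the copies of a repeated root are distinguished. The pairing `p` is induced by a root-path set
when the paths can be matched bijectively (by `e`) with the copies of the roots of `Q`, in such a
way that the path matched with a copy starts at that root and ends at its image under `p`. -/
def IsRootPairing (n : ℕ) (Q R : ℂ[X]) (P : unitInterval → ℂ[X]) (p : Q.roots ≃ R.roots) : Prop :=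
  P 0 = Q ∧ P 1 = R ∧
    ∃ γ : Fin n → unitInterval → ℂ, IsRootPathSet P γ ∧
      ∃ e : Fin n ≃ Q.roots, ∀ j, γ j 0 = (e j).1 ∧ γ j 1 = (p (e j)).1

/-! Put `h = g / (f + g)`. Then `f Q + g R = (f + g) ((1 - h) Q + h R)`, so its roots are those of
the affine line through `Q` and `R` at the real parameter `h α`, where `h 0 = 0` and `h 1 = 1`. Root
paths of the convex path extend to a real interval containing the range of `h`
(`exists_root_selection_extension`). Composing them with `h` keeps their end values, hence the
pairing. The extension rests on `exists_continuous_root_selection`: step functions are built by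
matching root tuples at successive nearby parameters, and their limit is taken along an ultrafilter.
Its continuity comes from `dist_chain_le`: small steps confined near at most `n` points cannot
travel far. -/

open Filter Topology

/-! ### Multisets as tuples, and short-step chains -/

/-- Two tuples with the same underlying multiset differ by a permutation of the indices. -/
theorem exists_perm_of_univ_map_eq {ι α : Type*} [Fintype ι] {v w : ι → α}
    (h : (Finset.univ : Finset ι).val.map v = (Finset.univ : Finset ι).val.map w) :
    ∃ σ : Equiv.Perm ι, ∀ i, w (σ i) = v i := by
  classical
  have hc : ∀ c, Nonempty ({i // v i = c} ≃ {i // w i = c}) := by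
    intro c
    have h1 := congrArg (Multiset.count c) h
    rw [Multiset.count_map, Multiset.count_map] at h1
    refine Fintype.card_eq.mp ?_
    rw [Fintype.card_subtype, Fintype.card_subtype]
    simpa [Finset.card, Finset.filter, eq_comm] using h1
  exact ⟨Equiv.ofFiberEquiv fun c => (hc c).some, fun i => Equiv.ofFiberEquiv_map _ i⟩

/-- A multiset with `n` elements is the multiset of entries of an `n`-tuple. -/
theorem exists_tuple_of_card_eq {α : Type*} {n : ℕ} (m : Multiset α) (hm : m.card = n) :
    ∃ z : Fin n → α, m = (Finset.univ : Finset (Fin n)).val.map z := by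
  induction m using Quotient.inductionOn with
  | _ l =>
    obtain rfl : l.length = n := by simpa using hm
    exact ⟨l.get, by simp⟩

theorem eq_prod_of_roots_eq {n : ℕ} {p : ℂ[X]} (hp : p.Monic) {z : Fin n → ℂ}
    (h : p.roots = (Finset.univ : Finset (Fin n)).val.map z) : p = ∏ j, (X - C (z j)) := by
  have h1 := (IsAlgClosed.splits p).eq_prod_roots_of_monic hp
  rw [h, Multiset.map_map] at h1
  exact h1

theorem roots_prod_X_sub_C_tuple {n : ℕ} (z : Fin n → ℂ) :
    (∏ j, (X - C (z j))).roots = (Finset.univ : Finset (Fin n)).val.map z := by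
  rw [← roots_multiset_prod_X_sub_C ((Finset.univ : Finset (Fin n)).val.map z), Multiset.map_map]
  rfl

/-- A discrete chain with steps at most `ρ` that stays within `ρ` of a finite set `F` has its ends
at distance at most `3ρ|F|`. -/
theorem dist_chain_le {E : Type*} [PseudoMetricSpace E] {ρ : ℝ} (hρ : 0 ≤ ρ) (a : ℕ → E)
    (F : Finset E) : ∀ p q : ℕ, p ≤ q → (∀ m, p ≤ m → m < q → dist (a m) (a (m + 1)) ≤ ρ) →
      (∀ m, p ≤ m → m ≤ q → ∃ x ∈ F, dist (a m) x ≤ ρ) →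
      dist (a p) (a q) ≤ 3 * ρ * F.card := by
  classical
  induction F using Finset.strongInduction with
  | H F ih =>
    intro p q hpq hstep hnear
    obtain ⟨x, hx, hpx⟩ := hnear p le_rfl hpq
    -- Take the last visit near `x`: the rest of the chain avoids `x`, so induction applies to
    -- `F.erase x`. Reaching `m` costs `2ρ` and the next step `ρ`.
    obtain ⟨m, ⟨⟨hpm, hmq⟩, hmx⟩, hmax⟩ : ∃ m, ((p ≤ m ∧ m ≤ q) ∧ dist (a m) x ≤ ρ) ∧
        ∀ k, m < k → k ≤ q → ¬ dist (a k) x ≤ ρ := by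
      have hne : ((Finset.Icc p q).filter fun m => dist (a m) x ≤ ρ).Nonempty :=
        ⟨p, by simp [hpq, hpx]⟩
      refine ⟨Finset.max' _ hne, by simpa using Finset.max'_mem _ hne, fun k hk hkq hkx => ?_⟩
      have hpm : p ≤ Finset.max' _ hne := Finset.le_max' _ _ (by simp [hpq, hpx])
      exact absurd (Finset.le_max' _ k (by simp [hkx, hkq]; omega)) (not_le.mpr hk)
    have h1 : dist (a p) (a m) ≤ 2 * ρ := by
      linarith [dist_triangle_right (a p) (a m) x]
    have hcard : ((F.erase x).card : ℝ) + 1 = F.card := by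
      exact_mod_cast Finset.card_erase_add_one hx
    have hnn : 0 ≤ 3 * ρ * (F.erase x).card := by positivity
    rcases hmq.eq_or_lt with rfl | hlt
    · nlinarith
    · have h2 := hstep m hpm hlt
      have h3 := ih _ (Finset.erase_ssubset hx) (m + 1) q hlt
        (fun k hk hkq => hstep k (by omega) hkq) (fun k hk hkq => by
          obtain ⟨y, hy, hky⟩ := hnear k (by omega) hkq
          refine ⟨y, Finset.mem_erase.mpr ⟨?_, hy⟩, hky⟩
          rintro rfl
          exact hmax k (by omega) hkq hky)
      have h4 := dist_triangle4 (a p) (a m) (a (m + 1)) (a q)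
      rw [← hcard]
      linarith

/-! ### Closedness, boundedness and uniform matching of roots -/

section RootSelection

variable {T : Type*} {n : ℕ} {P : T → ℂ[X]}

theorem continuous_eval_of_continuous_coeff [TopologicalSpace T]
    (hn : ∀ s, (P s).natDegree = n) (hc : ∀ k, Continuous fun s => (P s).coeff k) (x : ℂ) :
    Continuous fun s => (P s).eval x := by
  have h : (fun s => (P s).eval x) = fun s => ∑ i ∈ Finset.range (n + 1), (P s).coeff i * x ^ i := by
    funext s
    rw [eval_eq_sum_range, hn]
  rw [h]
  exact continuous_finsetSum _ fun i _ => (hc i).mul continuous_const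

/-- The relation "`z` lists the roots of `P s`" is closed. -/
theorem roots_eq_of_tendsto [TopologicalSpace T] (hm : ∀ s, (P s).Monic)
    (hn : ∀ s, (P s).natDegree = n)
    (hc : ∀ k, Continuous fun s => (P s).coeff k) {ι : Type*} {l : Filter ι} [l.NeBot]
    {s : ι → T} {z : ι → Fin n → ℂ} {s₀ : T} {z₀ : Fin n → ℂ} (hs : Tendsto s l (𝓝 s₀))
    (hz : Tendsto z l (𝓝 z₀))
    (h : ∀ k, (P (s k)).roots = (Finset.univ : Finset (Fin n)).val.map (z k)) :
    (P s₀).roots = (Finset.univ : Finset (Fin n)).val.map z₀ := by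
  have hP : P s₀ = ∏ j, (X - C (z₀ j)) := by
    refine Polynomial.funext fun x => ?_
    have h1 := ((continuous_eval_of_continuous_coeff hn hc x).tendsto s₀).comp hs
    have h2 : Tendsto (fun k => ∏ j, (x - z k j)) l (𝓝 (∏ j, (x - z₀ j))) :=
      tendsto_finsetProd _ fun j _ => tendsto_const_nhds.sub ((tendsto_pi_nhds.mp hz) j)
    have h3 : (fun s => (P s).eval x) ∘ s = fun k => ∏ j, (x - z k j) := by
      funext k
      simp only [Function.comp]
      rw [eq_prod_of_roots_eq (hm _) (h k), eval_prod]
      simp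
    rw [h3] at h1
    rw [tendsto_nhds_unique h1 h2, eval_prod]
    simp
  rw [hP, roots_prod_X_sub_C_tuple]

theorem exists_root_tuple (hn : ∀ s, (P s).natDegree = n) (s : T) :
    ∃ z : Fin n → ℂ, (P s).roots = (Finset.univ : Finset (Fin n)).val.map z :=
  exists_tuple_of_card_eq _ (by rw [IsAlgClosed.card_roots_eq_natDegree, hn])

/-- The Cauchy bound of a monic polynomial depends only on its lower coefficients, which are bounded
by compactness. -/
theorem exists_root_bound [TopologicalSpace T] [CompactSpace T] (hm : ∀ s, (P s).Monic)
    (hn : ∀ s, (P s).natDegree = n) (hc : ∀ k, Continuous fun s => (P s).coeff k) :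
    ∃ B : ℝ, ∀ s, ∀ z : Fin n → ℂ,
      (P s).roots = (Finset.univ : Finset (Fin n)).val.map z → z ∈ Metric.closedBall 0 B := by
  have hb : ∀ k, ∃ b : NNReal, ∀ s, ‖(P s).coeff k‖₊ ≤ b := by
    intro k
    obtain ⟨b, hb⟩ := (isCompact_range (hc k)).isBounded.exists_norm_le
    refine ⟨b.toNNReal, fun s => ?_⟩
    rw [← NNReal.coe_le_coe]
    exact (hb _ ⟨s, rfl⟩).trans (Real.le_coe_toNNReal b)
  choose b hb using hb
  refine ⟨((Finset.range n).sup b + 1 : NNReal), fun s z hz => ?_⟩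
  rw [mem_closedBall_zero_iff, pi_norm_le_iff_of_nonneg (NNReal.coe_nonneg _)]
  intro j
  have hj : z j ∈ (P s).roots := by
    rw [hz]
    exact Multiset.mem_map_of_mem _ (Finset.mem_univ j)
  have h1 := IsRoot.norm_lt_cauchyBound (hm s).ne_zero (isRoot_of_mem_roots hj)
  refine h1.le.trans (NNReal.coe_le_coe.mpr ?_)
  rw [cauchyBound, hn, (hm s).leadingCoeff]
  simp only [nnnorm_one, div_one]
  exact add_le_add_left (Finset.sup_mono_fun fun k _ => hb k s) 1

/-- Uniform continuity of the roots: the roots at nearby parameters can be matched. -/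
theorem exists_uniform_root_matching [PseudoMetricSpace T] [CompactSpace T]
    (hm : ∀ s, (P s).Monic) (hn : ∀ s, (P s).natDegree = n)
    (hc : ∀ k, Continuous fun s => (P s).coeff k) {ρ : ℝ} (hρ : 0 < ρ) :
    ∃ η > 0, ∀ s t, dist s t < η → ∀ z : Fin n → ℂ,
      (P s).roots = (Finset.univ : Finset (Fin n)).val.map z →
      ∃ w : Fin n → ℂ, (P t).roots = (Finset.univ : Finset (Fin n)).val.map w ∧ dist z w ≤ ρ := by
  by_contra! hcon
  choose s t hst z hz hfar using fun k : ℕ => hcon (1 / ((k : ℝ) + 1)) Nat.one_div_pos_of_nat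
  choose w hw using fun k => exists_root_tuple hn (t k)
  obtain ⟨B, hB⟩ := exists_root_bound hm hn hc
  -- Limits along an ultrafilter replace successive subsequences.
  let l : Ultrafilter ℕ := hyperfilter ℕ
  obtain ⟨s₀, -, hs₀⟩ := isCompact_univ.ultrafilter_le_nhds' (l.map s) univ_mem
  obtain ⟨z₀, -, hz₀⟩ := (isCompact_closedBall (0 : Fin n → ℂ) B).ultrafilter_le_nhds' (l.map z)
    (Ultrafilter.mem_map.mpr (univ_mem' fun k => hB _ _ (hz k)))
  obtain ⟨w₀, -, hw₀⟩ := (isCompact_closedBall (0 : Fin n → ℂ) B).ultrafilter_le_nhds' (l.map w)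
    (Ultrafilter.mem_map.mpr (univ_mem' fun k => hB _ _ (hw k)))
  change Tendsto s l (𝓝 s₀) at hs₀
  change Tendsto z l (𝓝 z₀) at hz₀
  change Tendsto w l (𝓝 w₀) at hw₀
  have hdist : Tendsto (fun k => dist (t k) (s k)) l (𝓝 0) := by
    refine Tendsto.mono_left ?_ Nat.hyperfilter_le_atTop
    refine squeeze_zero (fun k => dist_nonneg) (fun k => ?_) tendsto_one_div_add_atTop_nhds_zero_nat
    rw [dist_comm]
    exact (hst k).le
  have ht₀ : Tendsto t l (𝓝 s₀) := by
    rw [tendsto_iff_dist_tendsto_zero] at hs₀ ⊢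
    refine squeeze_zero (fun k => dist_nonneg) (fun k => dist_triangle (t k) (s k) s₀) ?_
    simpa using hdist.add hs₀
  have h1 := roots_eq_of_tendsto hm hn hc hs₀ hz₀ hz
  have h2 := roots_eq_of_tendsto hm hn hc ht₀ hw₀ hw
  -- Both limit tuples list the roots of `P s₀`, so permuting `w` brings it close to `z`, against
  -- `hfar`.
  obtain ⟨σ, hσ⟩ := exists_perm_of_univ_map_eq (h1.symm.trans h2)
  have hwσ : Tendsto (fun k => w k ∘ σ) l (𝓝 z₀) := by
    rw [tendsto_pi_nhds] at hw₀ ⊢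
    intro j
    rw [← hσ j]
    exact hw₀ (σ j)
  have hd := hz₀.dist hwσ
  rw [dist_self] at hd
  obtain ⟨k, hk⟩ := (hd.eventually (gt_mem_nhds hρ)).exists
  refine absurd hk (not_lt.mpr (hfar k (w k ∘ σ) ?_).le)
  rw [hw k, ← Multiset.map_map]
  congr 1
  exact (congrArg Finset.val (Finset.map_univ_equiv σ)).symm

end RootSelection

/-! ### Continuous selection of roots -/

/-- An approximate root selection: a step function with values in the root tuples at nearby
parameters, starting at `z₀`, whose oscillation is controlled up to the scale `δ`. -/
theorem exists_approx_root_selection {n : ℕ} {P : unitInterval → ℂ[X]}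
    (hm : ∀ s, (P s).Monic) (hn : ∀ s, (P s).natDegree = n)
    (hc : ∀ k, Continuous fun s => (P s).coeff k) {z₀ : Fin n → ℂ}
    (hz₀ : (P 0).roots = (Finset.univ : Finset (Fin n)).val.map z₀) {δ : ℝ} (hδ : 0 < δ) :
    ∃ (τ : unitInterval → unitInterval) (c : unitInterval → Fin n → ℂ), c 0 = z₀ ∧
      (∀ t, (P (τ t)).roots = (Finset.univ : Finset (Fin n)).val.map (c t)) ∧
      (∀ t, dist (τ t) t ≤ δ) ∧
      ∀ ρ η, δ ≤ ρ → (∀ s t, dist s t < η → ∀ z : Fin n → ℂ,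
        (P s).roots = (Finset.univ : Finset (Fin n)).val.map z →
        ∃ w : Fin n → ℂ, (P t).roots = (Finset.univ : Finset (Fin n)).val.map w ∧ dist z w ≤ ρ) →
        ∀ s t, dist s t + δ < η → dist (c s) (c t) ≤ 3 * ρ * n := by
  classical
  obtain ⟨θ, hθ, hθm⟩ := exists_uniform_root_matching hm hn hc hδ
  obtain ⟨N', hN'⟩ := exists_nat_one_div_lt (lt_min hθ hδ)
  obtain ⟨N, hN0, hNθ, hNδ⟩ : ∃ N : ℝ, 0 < N ∧ 1 / N < θ ∧ 1 / N < δ :=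
    ⟨N' + 1, by positivity, hN'.trans_le (min_le_left _ _), hN'.trans_le (min_le_right _ _)⟩
  -- Clamping at `1` lets the chain run over all of `ℕ`.
  let σ : ℕ → unitInterval := fun m => Set.projIcc 0 1 zero_le_one ((m : ℝ) / N)
  have hlip : ∀ x y : ℝ, dist (Set.projIcc (0 : ℝ) 1 zero_le_one x)
      (Set.projIcc 0 1 zero_le_one y) ≤ |x - y| := by
    intro x y
    simpa [Real.dist_eq] using (LipschitzWith.projIcc (zero_le_one' ℝ)).dist_le_mul x y
  have hσ : ∀ p q : ℕ, p ≤ q → dist (σ p) (σ q) ≤ ((q : ℝ) - p) / N := by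
    intro p q hpq
    have hpq' : (p : ℝ) ≤ q := by exact_mod_cast hpq
    refine (hlip _ _).trans (le_of_eq ?_)
    rw [abs_sub_comm, ← sub_div, abs_of_nonneg]
    exact div_nonneg (by linarith) hN0.le
  have hstep : ∀ m, dist (σ m) (σ (m + 1)) < θ := by
    intro m
    refine lt_of_le_of_lt (hσ m (m + 1) (Nat.le_succ m)) ?_
    simpa using hNθ
  choose w hw hwd using hθm
  let chain : (m : ℕ) →
      {z : Fin n → ℂ // (P (σ m)).roots = (Finset.univ : Finset (Fin n)).val.map z} := fun m =>
    Nat.rec ⟨z₀, by simpa [σ] using hz₀⟩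
      (fun m z => ⟨w _ _ (hstep m) z.1 z.2, hw _ _ (hstep m) z.1 z.2⟩) m
  have hchain0 : (chain 0).1 = z₀ := rfl
  have hchain : ∀ m, dist (chain m).1 (chain (m + 1)).1 ≤ δ := fun m =>
    hwd _ _ (hstep m) (chain m).1 (chain m).2
  let idx : unitInterval → ℕ := fun t => ⌊(t : ℝ) * N⌋₊
  have hidx : ∀ t : unitInterval, (idx t : ℝ) ≤ t * N ∧ (t : ℝ) * N < idx t + 1 := fun t =>
    ⟨Nat.floor_le (mul_nonneg t.2.1 hN0.le), Nat.lt_floor_add_one _⟩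
  refine ⟨fun t => σ (idx t), fun t => (chain (idx t)).1, ?_, fun t => (chain (idx t)).2, ?_, ?_⟩
  · have : idx 0 = 0 := by simp [idx]
    change (chain (idx 0)).1 = z₀
    rw [this, hchain0]
  · intro t
    have h1 : dist (σ (idx t)) t ≤ |(idx t : ℝ) / N - t| := by
      have := hlip ((idx t : ℝ) / N) t
      rwa [Set.projIcc_val] at this
    refine h1.trans (le_trans ?_ hNδ.le)
    obtain ⟨h2, h3⟩ := hidx t
    rw [abs_le]
    constructor
    · rw [neg_le_sub_iff_le_add, ← add_div, le_div_iff₀ hN0]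
      exact h3.le
    · have : (idx t : ℝ) / N ≤ t := by rwa [div_le_iff₀ hN0]
      have : 0 < 1 / N := by positivity
      linarith
  · intro ρ η hδρ hη s t hst
    wlog hle : s ≤ t generalizing s t
    · rw [dist_comm]
      exact this t s (by rwa [dist_comm]) (le_of_not_ge hle)
    have hle' : (s : ℝ) ≤ t := hle
    have hρ : 0 < ρ := hδ.trans_le hδρ
    have hpq : idx s ≤ idx t := Nat.floor_mono (mul_le_mul_of_nonneg_right hle' hN0.le)
    -- Rounding down to the grid lengthens the gap by less than `1 / N < δ`, whence the `δ` added to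
    -- `dist s t`.
    have hgap : ((idx t : ℝ) - idx s) / N < η := by
      refine lt_of_le_of_lt ?_ hst
      have h1 : dist s t = (t : ℝ) - s := by
        rw [Subtype.dist_eq, Real.dist_eq, abs_sub_comm, abs_of_nonneg (by linarith)]
      rw [h1, div_le_iff₀ hN0]
      have h2 : 1 ≤ δ * N := by
        rw [div_lt_iff₀ hN0] at hNδ
        exact hNδ.le
      have := (hidx t).1
      have := (hidx s).2
      nlinarith
    refine (dist_pi_le_iff (by positivity)).mpr fun j => ?_
    -- `F` holds the roots at the grid point of `s`. Matching at scale `η` keeps the chain within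
    -- `ρ` of `F` up to the index of `t`.
    let F : Finset ℂ := Finset.univ.image (chain (idx s)).1
    have hF : (F.card : ℝ) ≤ n := by
      exact_mod_cast Finset.card_image_le.trans (by simp)
    refine (dist_chain_le hρ.le (fun m => (chain m).1 j) F (idx s) (idx t) hpq ?_ ?_).trans ?_
    · exact fun m _ _ => ((dist_le_pi_dist _ _ j).trans (hchain m)).trans hδρ
    · intro m hpm hmq
      have hd : dist (σ m) (σ (idx s)) < η := by
        rw [dist_comm]
        refine ((hσ _ _ hpm).trans ?_).trans_lt hgap
        have : (m : ℝ) ≤ idx t := by exact_mod_cast hmq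
        gcongr
      obtain ⟨v, hv, hvd⟩ := hη _ _ hd (chain m).1 (chain m).2
      refine ⟨v j, ?_, (dist_le_pi_dist _ _ j).trans hvd⟩
      have h1 : v j ∈ (Finset.univ : Finset (Fin n)).val.map (chain (idx s)).1 := by
        rw [← (chain (idx s)).2, hv]
        exact Multiset.mem_map_of_mem _ (Finset.mem_univ j)
      obtain ⟨i, -, hi⟩ := Multiset.mem_map.mp h1
      exact Finset.mem_image.mpr ⟨i, Finset.mem_univ i, hi⟩
    · exact mul_le_mul_of_nonneg_left hF (by positivity)

/-- The roots of a continuous path of monic polynomials of degree `n` can be followed by `n`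
continuous functions, with prescribed initial values. -/
theorem exists_continuous_root_selection {n : ℕ} {P : unitInterval → ℂ[X]}
    (hm : ∀ s, (P s).Monic) (hn : ∀ s, (P s).natDegree = n)
    (hc : ∀ k, Continuous fun s => (P s).coeff k) {z₀ : Fin n → ℂ}
    (hz₀ : (P 0).roots = (Finset.univ : Finset (Fin n)).val.map z₀) :
    ∃ γ : unitInterval → Fin n → ℂ, Continuous γ ∧ γ 0 = z₀ ∧
      ∀ t, (P t).roots = (Finset.univ : Finset (Fin n)).val.map (γ t) := by
  choose τ c hc0 hcr hτ hosc using fun k : ℕ =>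
    exists_approx_root_selection hm hn hc hz₀ (Nat.one_div_pos_of_nat (α := ℝ) (n := k))
  obtain ⟨B, hB⟩ := exists_root_bound hm hn hc
  let l : Ultrafilter ℕ := hyperfilter ℕ
  have hlim : ∀ t, ∃ y, Tendsto (fun k => c k t) l (𝓝 y) := by
    intro t
    obtain ⟨y, -, hy⟩ := (isCompact_closedBall (0 : Fin n → ℂ) B).ultrafilter_le_nhds'
      (l.map fun k => c k t) (Ultrafilter.mem_map.mpr (univ_mem' fun k => hB _ _ (hcr k t)))
    exact ⟨y, hy⟩
  choose γ hγ using hlim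
  have hsmall : Tendsto (fun k : ℕ => 1 / ((k : ℝ) + 1)) l (𝓝 0) :=
    tendsto_one_div_add_atTop_nhds_zero_nat.mono_left Nat.hyperfilter_le_atTop
  refine ⟨γ, ?_, ?_, ?_⟩
  · rw [Metric.continuous_iff]
    intro t ε hε
    -- This choice makes the oscillation bound `3 * ρ * n` smaller than `ε`.
    have hρ : 0 < ε / (3 * n + 1) := by positivity
    obtain ⟨η, hη, hmatch⟩ := exists_uniform_root_matching hm hn hc hρ
    refine ⟨η / 2, by positivity, fun s hst => ?_⟩
    have hev : ∀ᶠ k in (l : Filter ℕ), dist (c k s) (c k t) ≤ 3 * (ε / (3 * n + 1)) * n := by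
      filter_upwards [hsmall.eventually (gt_mem_nhds hρ),
        hsmall.eventually (gt_mem_nhds (half_pos hη))] with k h1 h2
      exact hosc k _ η h1.le hmatch s t (by linarith)
    have hle := le_of_tendsto ((hγ s).dist (hγ t)) hev
    refine hle.trans_lt ?_
    have : 3 * (ε / (3 * n + 1)) * n = ε * ((3 * n) / (3 * n + 1)) := by ring
    rw [this]
    refine mul_lt_of_lt_one_right hε ?_
    rw [div_lt_one (by positivity)]
    linarith
  · refine tendsto_nhds_unique (hγ 0) ?_
    simp only [hc0]
    exact tendsto_const_nhds
  · intro t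
    refine roots_eq_of_tendsto hm hn hc (s := fun k => τ k t) ?_ (hγ t) fun k => hcr k t
    rw [tendsto_iff_dist_tendsto_zero]
    exact squeeze_zero (fun k => dist_nonneg) (fun k => hτ k t) hsmall

/-! ### Root paths along the real line through `Q` and `R` -/

/-- The affine line `s ↦ (1 - s) Q + s R`, for all real `s`. -/
noncomputable def linePoly (Q R : ℂ[X]) (s : ℝ) : ℂ[X] :=
  C (((1 - s : ℝ)) : ℂ) * Q + C ((s : ℝ) : ℂ) * R

section Line

variable {n : ℕ} {Q R : ℂ[X]}

/-- The weights `1 - s` and `s` sum to `1`, so the leading coefficient stays `1` even outside `[0,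
1]`. -/
theorem linePoly_monic_natDegree (hQ : Q.Monic) (hQn : Q.natDegree = n) (hR : R.Monic)
    (hRn : R.natDegree = n) (s : ℝ) :
    (linePoly Q R s).Monic ∧ (linePoly Q R s).natDegree = n := by
  have hle : (linePoly Q R s).natDegree ≤ n :=
    natDegree_add_le_of_degree_le ((natDegree_C_mul_le _ _).trans hQn.le)
      ((natDegree_C_mul_le _ _).trans hRn.le)
  have hco : (linePoly Q R s).coeff n = 1 := by
    have h1 : Q.coeff n = 1 := hQn ▸ hQ.coeff_natDegree
    have h2 : R.coeff n = 1 := hRn ▸ hR.coeff_natDegree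
    rw [linePoly, coeff_add, coeff_C_mul, coeff_C_mul, h1, h2]
    push_cast
    ring
  exact ⟨monic_of_natDegree_le_of_coeff_eq_one n hle hco,
    natDegree_eq_of_le_of_coeff_ne_zero hle (by simp [hco])⟩

theorem continuous_coeff_linePoly (k : ℕ) : Continuous fun s => (linePoly Q R s).coeff k := by
  simp only [linePoly, coeff_add, coeff_C_mul]
  fun_prop

/-- Root paths over `[0, 1]` of the line through `Q` and `R` extend to every interval
`[-M, 1 + M]`. -/
theorem exists_root_selection_extension (hQ : Q.Monic) (hQn : Q.natDegree = n) (hR : R.Monic)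
    (hRn : R.natDegree = n) {γ : Fin n → unitInterval → ℂ}
    (hγ : IsRootPathSet (convexPolyPath Q R) γ) {M : ℝ} (hM : 0 < M) :
    ∃ Γ : Fin n → ℝ → ℂ, (∀ j, Continuous (Γ j)) ∧ (∀ j, Γ j 0 = γ j 0) ∧ (∀ j, Γ j 1 = γ j 1) ∧
      ∀ s, -M ≤ s → s ≤ 1 + M →
        (linePoly Q R s).roots = (Finset.univ : Finset (Fin n)).val.map fun j => Γ j s := by
  have hP := linePoly_monic_natDegree hQ hQn hR hRn
  have hline : ∀ s : unitInterval, linePoly Q R s = convexPolyPath Q R s := fun s => rfl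
  -- `L` follows the roots backwards from `0` to `-M`; `U` below goes forwards from `1` to `1 + M`.
  obtain ⟨L, hLc, hL0, hL⟩ := exists_continuous_root_selection
    (P := fun u : unitInterval => linePoly Q R (-M * u)) (n := n) (z₀ := fun j => γ j 0)
    (fun u => (hP _).1) (fun u => (hP _).2)
    (fun k => (continuous_coeff_linePoly k).comp (by fun_prop))
    (by simpa using (congrArg roots (hline 0)).trans (hγ.2 0))
  obtain ⟨U, hUc, hU0, hU⟩ := exists_continuous_root_selection
    (P := fun u : unitInterval => linePoly Q R (1 + M * u)) (n := n) (z₀ := fun j => γ j 1)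
    (fun u => (hP _).1) (fun u => (hP _).2)
    (fun k => (continuous_coeff_linePoly k).comp (by fun_prop))
    (by simpa using (congrArg roots (hline 1)).trans (hγ.2 1))
  let π : ℝ → unitInterval := Set.projIcc 0 1 zero_le_one
  have hπ : Continuous π := continuous_projIcc
  have hπ0 : ∀ x ≤ 0, π x = 0 := fun x hx => Set.projIcc_of_le_left _ hx
  have hπ1 : ∀ x, 1 ≤ x → π x = 1 := fun x hx => Set.projIcc_of_right_le _ hx
  have hπm : ∀ x, 0 ≤ x → x ≤ 1 → (π x : ℝ) = x := fun x h0 h1 => by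
    simp [π, Set.projIcc_of_mem zero_le_one ⟨h0, h1⟩]
  -- Each clamped piece is constant outside its own interval, and subtracting the two junction
  -- values cancels the inactive pieces. The sum form makes continuity immediate.
  have hval : ∀ (s : ℝ) j, L (π (-s / M)) j + γ j (π s) + U (π ((s - 1) / M)) j - γ j 0 - γ j 1 =
      if s ≤ 0 then L (π (-s / M)) j else if s ≤ 1 then γ j (π s) else U (π ((s - 1) / M)) j := by
    intro s j
    split_ifs with h0 h1
    · rw [hπ0 s h0, hπ0 ((s - 1) / M) (div_nonpos_of_nonpos_of_nonneg (by linarith) hM.le), hU0]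
      ring
    · rw [hπ0 (-s / M) (div_nonpos_of_nonpos_of_nonneg (by linarith) hM.le), hL0,
        hπ0 ((s - 1) / M) (div_nonpos_of_nonpos_of_nonneg (by linarith) hM.le), hU0]
      ring
    · rw [hπ0 (-s / M) (div_nonpos_of_nonpos_of_nonneg (by linarith) hM.le), hL0,
        hπ1 s (by linarith)]
      ring
  refine ⟨fun j s => L (π (-s / M)) j + γ j (π s) + U (π ((s - 1) / M)) j - γ j 0 - γ j 1,
    fun j => ?_, fun j => ?_, fun j => ?_, fun s hs0 hs1 => ?_⟩
  · have h1 := hγ.1 j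
    have h2 : Continuous fun s : ℝ => L (π (-s / M)) j :=
      (continuous_apply j).comp (hLc.comp (hπ.comp (by fun_prop)))
    have h3 : Continuous fun s : ℝ => U (π ((s - 1) / M)) j :=
      (continuous_apply j).comp (hUc.comp (hπ.comp (by fun_prop)))
    exact (((h2.add (h1.comp hπ)).add h3).sub continuous_const).sub continuous_const
  · simp only [hval]
    simp [hπ0 0 le_rfl, hL0]
  · simp only [hval]
    simp [hπ1 1 le_rfl]
  · simp only [hval]
    split_ifs with h0 h1
    · rw [← hL]
      rw [hπm _ (div_nonneg (by linarith) hM.le) ((div_le_one hM).mpr (by linarith))]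
      congr 2
      field_simp
    · rw [← hγ.2, ← hline, hπm s (by linarith) h1]
    · rw [← hU]
      rw [hπm _ (div_nonneg (by linarith) hM.le) ((div_le_one hM).mpr (by linarith))]
      congr 2
      field_simp
      ring

end Line

/-! ### Reparametrisation by `h` -/

theorem mainTheorem9 (n : ℕ) (Q R : ℂ[X])
    (hQ : Q.Monic) (hQn : Q.natDegree = n) (hR : R.Monic) (hRn : R.natDegree = n)
    (f g : unitInterval → ℝ) (hf : Continuous f) (hg : Continuous g)
    (hf0 : f 0 = 1) (hg1 : g 1 = 1) (hf1 : f 1 = 0) (hg0 : g 0 = 0)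
    (hdeg : ∀ α, (combPolyPath f g Q R α).degree = n)
    (hfg : ∀ α, 0 ≤ max (f α) (g α))
    (p : Q.roots ≃ R.roots)
    (hp : IsRootPairing n Q R (convexPolyPath Q R) p) :
    IsRootPairing n Q R (combPolyPath f g Q R) p := by
  obtain ⟨-, -, γ, hγ, e, he⟩ := hp
  have hne : ∀ α, f α + g α ≠ 0 := by
    intro α h0
    have h1 : Q.coeff n = 1 := hQn ▸ hQ.coeff_natDegree
    have h2 : R.coeff n = 1 := hRn ▸ hR.coeff_natDegree
    refine coeff_ne_zero_of_eq_degree (hdeg α) ?_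
    simp only [combPolyPath, coeff_add, coeff_C_mul, h1, h2, mul_one]
    exact_mod_cast h0
  let h : unitInterval → ℝ := fun α => g α / (f α + g α)
  have hcont : Continuous h := hg.div (hf.add hg) hne
  have hcomb : ∀ α, combPolyPath f g Q R α =
      C ((f α + g α : ℝ) : ℂ) * linePoly Q R (h α) := by
    intro α
    have h1 : f α = (f α + g α) * (1 - h α) := by
      have := hne α
      simp only [h]
      field_simp
      ring
    have h2 : g α = (f α + g α) * h α := by
      have := hne α
      simp only [h]
      field_simp
    rw [linePoly, mul_add, ← mul_assoc, ← mul_assoc, ← C_mul, ← C_mul, ← Complex.ofReal_mul,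
      ← Complex.ofReal_mul, ← h1, ← h2]
    rfl
  -- The bound `|b| + 1` serves as the `M` of the extension, which must be positive.
  obtain ⟨b, hb⟩ := (isCompact_range hcont).isBounded.exists_norm_le
  have hbd : ∀ α, |h α| ≤ |b| + 1 := fun α => by
    have := hb _ ⟨α, rfl⟩
    rw [Real.norm_eq_abs] at this
    linarith [le_abs_self b]
  obtain ⟨Γ, hΓc, hΓ0, hΓ1, hΓ⟩ := exists_root_selection_extension hQ hQn hR hRn hγ
    (M := |b| + 1) (by positivity)
  have hh0 : h 0 = 0 := by simp [h, hg0]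
  have hh1 : h 1 = 1 := by simp [h, hf1, hg1]
  refine ⟨by simp [combPolyPath, hf0, hg0], by simp [combPolyPath, hf1, hg1],
    fun j α => Γ j (h α), ⟨fun j => (hΓc j).comp hcont, fun α => ?_⟩, e, fun j => ?_⟩
  · rw [hcomb, roots_C_mul _ (by exact_mod_cast hne α)]
    obtain ⟨h1, h2⟩ := abs_le.mp (hbd α)
    exact hΓ _ h1 (by linarith)
  · simp only [hh0, hh1, hΓ0, hΓ1]
    exact he j
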